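/- Let $\Lambda\subset\mathbb R^2$ be a lattice generated by two linearly independent periods, and let $\Omega$ be a periodic domain, i.e. a fundamental region of $\Lambda$ (for instance a rectangle with opposite sides identified), given as a finite union of closed nondegenerate triangles $T$ forming a conforming periodic mesh: the $\Lambda$-translates of the triangles cover the plane, have pairwise disjoint interiors, and every edge of a triangle is, up to a translation in $\Lambda$, an edge of another triangle (so that mesh nodes on opposite sides of $\Omega$ coincide). Let $N\ge 1$ and define the following spaces of piecewise polynomial fields. * $\mathrm{CG}_N$: scalar fields that are polynomials of degree $\le N$ on each triangle and are continuous and $\Lambda$-periodic. * $\mathrm{DG}_{N-1}$: scalar fields that are polynomials of degree $\le N-1$ on each triangle, with no continuity requirement. * $\mathrm{RT}_N$: vector fields that on each triangle belong to $[P_{N-1}]^2+\vec x\,P_{N-1}$ and whose normal component is continuous across every edge, including the edges identified by periodicity. For a scalar $w$ and a vector $\vec v$ write $\nabla\times w=(\partial_y w,-\partial_x w)$ and $w\times\vec v=(-w v_y,w v_x)$; derivatives are taken triangle by triangle, and $\langle\cdot,\cdot\rangle$ is the $L^2(\Omega)$ inner product. Let $\nu\in\mathbb R$, $\Delta t\neq0$,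 and let $\sigma\in\{1,-1\}$ be the sign convention of the diffusion term (integration by parts gives $\sigma=-1$; the result holds for either sign). Given $\vec u_h^{\,k+1/2}\in\mathrm{RT}_N$ and $\omega_h^k\in\mathrm{CG}_N$, one step of the staggered midpoint MEEVC scheme produces $\vec u_h^{\,k+3/2}\in\mathrm{RT}_N$, $\bar p_h^{\,k+1}\in\mathrm{DG}_{N-1}$ and $\omega_h^{k+1}\in\mathrm{CG}_N$ such that, with $\bar\omega=\tfrac12(\omega_h^{k+1}+\omega_h^k)$, $$\Big\langle\tfrac{\vec u_h^{\,k+3/2}-\vec u_h^{\,k+1/2}}{\Delta t},\vec v_h\Big\rangle+\Big\langle\omega_h^{k+1}\times\tfrac{\vec u_h^{\,k+3/2}+\vec u_h^{\,k+1/2}}{2},\vec v_h\Big\rangle-\langle\bar p_h^{\,k+1},\nabla\cdot\vec v_h\rangle=-\nu\langle\nabla\times\omega_h^{k+1},\vec v_h\rangle,$$ $$\Big\langle\tfrac{\omega_h^{k+1}-\omega_h^k}{\Delta t},\xi_h\Big\rangle-\tfrac12\langle\bar\omega,\nabla\cdot(\vec u_h^{\,k+1/2}\xi_h)\rangle+\tfrac12\langle\nabla\cdot(\vec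 u_h^{\,k+1/2}\bar\omega),\xi_h\rangle=\sigma\nu\langle\nabla\times\bar\omega,\nabla\times\xi_h\rangle,$$ $$\langle\nabla\cdot\vec u_h^{\,k+3/2},q_h\rangle=0$$ for all $\vec v_h\in\mathrm{RT}_N$, $\xi_h\in\mathrm{CG}_N$, $q_h\in\mathrm{DG}_{N-1}$. 1. Suppose $K\ge0$ steps of the scheme (for $k=0,\dots,K-1$) are performed from $\omega_h^0\in\mathrm{CG}_N$ and $\vec u_h^{\,1/2}\in\mathrm{RT}_N$, where $\langle\nabla\cdot\vec u_h^{\,1/2},q_h\rangle=0$ for all $q_h\in\mathrm{DG}_{N-1}$. Then every discrete velocity $\vec u_h^{\,k+1/2}$, $0\le k\le K$, is exactly divergence free, so mass is conserved: $\nabla\cdot\vec u_h^{\,k+1/2}=0$ at every point of every triangle, and also weakly on the periodic domain, i.e. $\int_\Omega\vec u_h^{\,k+1/2}\cdot\nabla\varphi=0$ for all $\Lambda$-periodic $\varphi\in C^1(\mathbb R^2)$. Moreover the total vorticity is conserved: $\int_\Omega\omega_h^{k+1}=\int_\Omega\omega_h^k$ for all $0\le k<K$. 2. The same holds for the implicit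 midpoint step used to start the scheme. Let $\vec u_h^{\,0}\in\mathrm{RT}_N$ satisfy $\langle\nabla\cdot\vec u_h^{\,0},q_h\rangle=0$ for all $q_h\in\mathrm{DG}_{N-1}$, let $\omega_h^0\in\mathrm{CG}_N$, and put $\tilde u=\tfrac12(\vec u_h^{\,1}+\vec u_h^{\,0})$, $\tilde\omega=\tfrac12(\omega_h^1+\omega_h^0)$. Suppose $\vec u_h^{\,1}\in\mathrm{RT}_N$, $\tilde p\in\mathrm{DG}_{N-1}$, $\omega_h^1\in\mathrm{CG}_N$ satisfy, for all $\vec v_h\in\mathrm{RT}_N$, $\xi_h\in\mathrm{CG}_N$, $q_h\in\mathrm{DG}_{N-1}$, $$\Big\langle\tfrac{\vec u_h^{\,1}-\vec u_h^{\,0}}{\Delta t},\vec v_h\Big\rangle+\langle\tilde\omega\times\tilde u,\vec v_h\rangle-\langle\tilde p,\nabla\cdot\vec v_h\rangle=-\nu\langle\nabla\times\tilde\omega,\vec v_h\rangle,$$ $$\Big\langle\tfrac{\omega_h^1-\omega_h^0}{\Delta t},\xi_h\Big\rangle-\tfrac12\langle\tilde\omega,\nabla\cdot(\tilde u\,\xi_h)\rangle+\tfrac12\langle\nabla\cdot(\tilde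 u\,\tilde\omega),\xi_h\rangle=\sigma\nu\langle\nabla\times\tilde\omega,\nabla\times\xi_h\rangle,\qquad\langle\nabla\cdot\vec u_h^{\,1},q_h\rangle=0.$$ Then $\vec u_h^{\,0}$, $\vec u_h^{\,1}$ and $\tilde u$ (the starting velocity $\vec u_h^{\,1/2}$) are exactly divergence free in both senses above, and $\int_\Omega\omega_h^1=\int_\Omega\omega_h^0$. -/

import Mathlib

namespace MEEVC

noncomputable section

/-- The plane `ℝ²`, with Lebesgue measure. -/
abbrev Plane := Fin 2 → ℝ

/-- Real polynomials in the two coordinates `x = X 0`, `y = X 1`. -/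
abbrev Poly := MvPolynomial (Fin 2) ℝ

/-! ### Periodic triangular meshes -/

/-- The element `m 0 • e₀ + m 1 • e₁` of the period lattice generated by `e₀, e₁`. -/
def latticeShift (e : Fin 2 → Plane) (m : Fin 2 → ℤ) : Plane :=
  ∑ j, (m j : ℝ) • e j

/-- The closed triangle with the given vertices. -/
def triangle (a : Fin 3 → Plane) : Set Plane :=
  convexHull ℝ (Set.range a)

/-- The unordered pair of end points of the edge opposite to vertex `i`. -/
def triangleEdge (a : Fin 3 → Plane) (i : Fin 3) : Sym2 Plane :=
  s(a (i + 1), a (i + 2))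

/-- A conforming periodic triangular mesh with triangles indexed by `ι`. The domain `Ω` is the
union of the triangles; it is a fundamental region of the lattice of periods (for instance a
rectangle whose opposite sides are identified and carry the same nodes). -/
structure PeriodicMesh (ι : Type*) where
  /-- two generators of the lattice of periods -/
  period : Fin 2 → Plane
  period_independent : LinearIndependent ℝ period
  /-- the vertices of the triangles -/
  vert : ι → Fin 3 → Plane
  nondegenerate : ∀ T, AffineIndependent ℝ (vert T)
  /-- the periodic copies of the triangles cover the plane -/
  cover : ∀ x : Plane, ∃ T m, x + latticeShift period m ∈ triangle (vert T)
  /-- different triangles, or different periodic copies, have disjoint interiors -/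
  disjoint : ∀ (T T' : ι) (m : Fin 2 → ℤ) (x : Plane), x ∈ interior (triangle (vert T)) →
    x + latticeShift period m ∈ interior (triangle (vert T')) → T = T' ∧ m = 0
  /-- modulo periods, every edge of a triangle is also an edge of another triangle -/
  conforming : ∀ (T : ι) (i : Fin 3), ∃ (T' : ι) (i' : Fin 3) (m : Fin 2 → ℤ),
    ¬ (T' = T ∧ m = 0) ∧
      (triangleEdge (vert T) i).map (fun x => x + latticeShift period m)
        = triangleEdge (vert T') i'

namespace PeriodicMesh

variable {ι : Type*} (M : PeriodicMesh ι)

/-- The translation by the period with integer coordinates `m`. -/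
def shift (m : Fin 2 → ℤ) : Plane := latticeShift M.period m

/-- The closed triangle with index `T`. -/
def cell (T : ι) : Set Plane := triangle (M.vert T)

/-- The end points of the `i`-th edge of the triangle `T`. -/
def edge (T : ι) (i : Fin 3) : Sym2 Plane := triangleEdge (M.vert T) i

/-- The `i`-th edge of the triangle `T` as a segment. -/
def edgeSegment (T : ι) (i : Fin 3) : Set Plane :=
  segment ℝ (M.vert T (i + 1)) (M.vert T (i + 2))

/-- A (non-normalised) normal vector of the `i`-th edge of the triangle `T`: the edge vector
turned by a right angle. -/
def edgeNormal (T : ι) (i : Fin 3) : Plane :=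
  ![M.vert T (i + 2) 1 - M.vert T (i + 1) 1, -(M.vert T (i + 2) 0 - M.vert T (i + 1) 0)]

end PeriodicMesh

/-! ### Piecewise polynomial fields

A piecewise polynomial scalar (vector) field is the family of its restrictions to the triangles. -/

/-- Piecewise polynomial scalar fields. -/
abbrev ScalarField (ι : Type*) := ι → Poly

/-- Piecewise polynomial vector fields. -/
abbrev VectorField (ι : Type*) := ι → Fin 2 → Poly

variable {ι : Type*}

/-- The divergence `∂ₓ v₀ + ∂ᵧ v₁`. -/
def div (v : VectorField ι) : ScalarField ι := fun T =>
  MvPolynomial.pderiv 0 (v T 0) + MvPolynomial.pderiv 1 (v T 1)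

/-- The curl `∇ × w = (∂ᵧ w, -∂ₓ w)` of a scalar field. -/
def curl (w : ScalarField ι) : VectorField ι := fun T =>
  ![MvPolynomial.pderiv 1 (w T), -MvPolynomial.pderiv 0 (w T)]

/-- The product of a vector field and a scalar field. -/
def mulField (v : VectorField ι) (w : ScalarField ι) : VectorField ι := fun T i => v T i * w T

/-- The planar cross product `w × v = (-w v₁, w v₀)`, that is `(w e_z) × v`. -/
def cross (w : ScalarField ι) (v : VectorField ι) : VectorField ι := fun T =>
  ![-(w T * v T 1), w T * v T 0]

/-- Polynomials of total degree at most `k`. -/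
abbrev polyLE (k : ℕ) : Submodule ℝ Poly := MvPolynomial.restrictTotalDegree (Fin 2) ℝ k

/-- The local Raviart-Thomas space of degree `N ≥ 1`, `[P_{N-1}]² + x P_{N-1}` (so that `N = 1` is
the lowest order). -/
def localRT (N : ℕ) : Submodule ℝ (Fin 2 → Poly) where
  carrier := {v | ∃ q : Fin 2 → Poly, ∃ r : Poly, (∀ i, q i ∈ polyLE (N - 1)) ∧
    r ∈ polyLE (N - 1) ∧ ∀ i, v i = q i + MvPolynomial.X i * r}
  zero_mem' := ⟨0, 0, fun _ => Submodule.zero_mem _, Submodule.zero_mem _, fun i => by simp⟩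
  add_mem' := by
    rintro v w ⟨q, r, hq, hr, hv⟩ ⟨q', r', hq', hr', hw⟩
    refine ⟨q + q', r + r', fun i => Submodule.add_mem _ (hq i) (hq' i),
      Submodule.add_mem _ hr hr', fun i => ?_⟩
    simp only [Pi.add_apply, hv, hw]
    ring
  smul_mem' := by
    rintro c v ⟨q, r, hq, hr, hv⟩
    refine ⟨c • q, c • r, fun i => Submodule.smul_mem _ c (hq i),
      Submodule.smul_mem _ c hr, fun i => ?_⟩
    simp only [Pi.smul_apply, hv, smul_add, mul_smul_comm]

namespace PeriodicMesh

variable (M : PeriodicMesh ι)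

/-- `DG_k`: discontinuous piecewise polynomials of degree at most `k`. -/
def DG (_M : PeriodicMesh ι) (k : ℕ) : Submodule ℝ (ScalarField ι) where
  carrier := {q | ∀ T, q T ∈ polyLE k}
  zero_mem' := fun _ => Submodule.zero_mem _
  add_mem' := fun hp hq T => Submodule.add_mem _ (hp T) (hq T)
  smul_mem' := fun c _ hq T => Submodule.smul_mem _ c (hq T)

/-- `CG_N`: continuous periodic piecewise polynomials of degree at most `N`. -/
def CG (N : ℕ) : Submodule ℝ (ScalarField ι) where
  carrier := {w | (∀ T, w T ∈ polyLE N) ∧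
    ∀ (T T' : ι) (m : Fin 2 → ℤ) (x : Plane), x ∈ M.cell T → x + M.shift m ∈ M.cell T' →
      MvPolynomial.eval x (w T) = MvPolynomial.eval (x + M.shift m) (w T')}
  zero_mem' := ⟨fun _ => Submodule.zero_mem _, fun _ _ _ _ _ _ => by simp⟩
  add_mem' := fun hv hw => ⟨fun T => Submodule.add_mem _ (hv.1 T) (hw.1 T),
    fun T T' m x h h' => by simp [hv.2 T T' m x h h', hw.2 T T' m x h h']⟩
  smul_mem' := fun c _ hw => ⟨fun T => Submodule.smul_mem _ c (hw.1 T),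
    fun T T' m x h h' => by simp [MvPolynomial.smul_eval, hw.2 T T' m x h h']⟩

/-- The normal component, with respect to the normal `n`, of a polynomial vector field at `x`. -/
def normalComponent (n : Plane) (v : Fin 2 → Poly) (x : Plane) : ℝ :=
  ∑ j, MvPolynomial.eval x (v j) * n j

/-- `RT_N`: periodic piecewise Raviart-Thomas fields of degree `N` whose normal component is
continuous across every edge shared (modulo periods) by two triangles. -/
def RT (N : ℕ) : Submodule ℝ (VectorField ι) where
  carrier := {v | (∀ T, v T ∈ localRT N) ∧
    ∀ (T T' : ι) (i i' : Fin 3) (m : Fin 2 → ℤ),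
      (M.edge T i).map (fun x => x + M.shift m) = M.edge T' i' →
      ∀ x ∈ M.edgeSegment T i, normalComponent (M.edgeNormal T i) (v T) x
        = normalComponent (M.edgeNormal T i) (v T') (x + M.shift m)}
  zero_mem' := ⟨fun _ => Submodule.zero_mem _, fun _ _ _ _ _ _ _ _ => by simp [normalComponent]⟩
  add_mem' := fun hv hw => ⟨fun T => Submodule.add_mem _ (hv.1 T) (hw.1 T),
    fun T T' i i' m h x hx => by
      have h1 := hv.2 T T' i i' m h x hx
      have h2 := hw.2 T T' i i' m h x hx
      simp only [normalComponent, Fin.sum_univ_two, Pi.add_apply, map_add] at h1 h2 ⊢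
      linear_combination h1 + h2⟩
  smul_mem' := fun c _ hw => ⟨fun T => Submodule.smul_mem _ c (hw.1 T),
    fun T T' i i' m h x hx => by
      have h1 := hw.2 T T' i i' m h x hx
      simp only [normalComponent, Fin.sum_univ_two, Pi.smul_apply,
        MvPolynomial.smul_eval] at h1 ⊢
      linear_combination c * h1⟩

variable [Fintype ι]

/-- The integral over `Ω` of a piecewise polynomial scalar field. -/
def integral (f : ScalarField ι) : ℝ :=
  ∑ T, ∫ x in M.cell T, MvPolynomial.eval x (f T)

/-- The `L²(Ω)` inner product of scalar fields. -/
def inner (f g : ScalarField ι) : ℝ :=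
  ∑ T, ∫ x in M.cell T, MvPolynomial.eval x (f T) * MvPolynomial.eval x (g T)

/-- The `L²(Ω)` inner product of vector fields. -/
def vinner (v w : VectorField ι) : ℝ :=
  ∑ T, ∫ x in M.cell T, ∑ j, MvPolynomial.eval x (v T j) * MvPolynomial.eval x (w T j)

/-- The discrete divergence constraint `⟨∇ · v, q⟩ = 0` for all `q ∈ DG_{N-1}`. -/
def DiscreteDivConstraint (N : ℕ) (v : VectorField ι) : Prop :=
  ∀ q ∈ M.DG (N - 1), M.inner (div v) q = 0

/-- The divergence vanishes at every point of every (closed) triangle. -/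
def PointwiseDivFree (v : VectorField ι) : Prop :=
  ∀ T, ∀ x ∈ M.cell T, MvPolynomial.eval x (div v T) = 0

/-- The weak divergence on the whole periodic domain vanishes: `∫_Ω v · ∇φ = 0` for every periodic
test function `φ`. -/
def WeaklyDivFree (v : VectorField ι) : Prop :=
  ∀ φ : Plane → ℝ, ContDiff ℝ 1 φ → (∀ x m, φ (x + M.shift m) = φ x) →
    ∑ T, ∫ x in M.cell T, fderiv ℝ φ x (fun j => MvPolynomial.eval x (v T j)) = 0

/-! ### The scheme

`ν` is the viscosity, `Δt` the time step and `σ` the sign of the diffusion term of the vorticity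
equation. -/

/-- The midpoint vorticity equation from `w` to `w'` with transporting velocity `u`. -/
def VorticityEquation (N : ℕ) (ν σ Δt : ℝ) (u : VectorField ι) (w w' : ScalarField ι) : Prop :=
  ∀ ξ ∈ M.CG N,
    M.inner (Δt⁻¹ • (w' - w)) ξ
      - (1 / 2) * M.inner ((1 / 2 : ℝ) • (w' + w)) (div (mulField u ξ))
      + (1 / 2) * M.inner (div (mulField u ((1 / 2 : ℝ) • (w' + w)))) ξ
      = σ * ν * M.vinner (curl ((1 / 2 : ℝ) • (w' + w))) (curl ξ)

/-- The midpoint momentum equation from `u` to `u'`, with vorticity `w` and total pressure `p`. -/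
def MomentumEquation (N : ℕ) (ν Δt : ℝ) (u u' : VectorField ι) (p w : ScalarField ι) : Prop :=
  ∀ v ∈ M.RT N,
    M.vinner (Δt⁻¹ • (u' - u)) v
      + M.vinner (cross w ((1 / 2 : ℝ) • (u' + u))) v
      - M.inner p (div v)
      = -ν * M.vinner (curl w) v

/-- One staggered step: from the known `u = u^{k+1/2}`, `w = ω^k` to
`u' = u^{k+3/2}`, `p' = p^{k+1}`, `w' = ω^{k+1}`. -/
structure IsStaggeredStep (N : ℕ) (ν σ Δt : ℝ) (u : VectorField ι) (w : ScalarField ι)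
    (u' : VectorField ι) (p' w' : ScalarField ι) : Prop where
  velocity_mem : u' ∈ M.RT N
  pressure_mem : p' ∈ M.DG (N - 1)
  vorticity_mem : w' ∈ M.CG N
  momentum : M.MomentumEquation N ν Δt u u' p' w'
  vorticity : M.VorticityEquation N ν σ Δt u w w'
  divergence : M.DiscreteDivConstraint N u'

/-- `K` consecutive steps of the staggered scheme, where `u k = u^{k+1/2}`, `w k = ω^k` and
`p k = p^k`. The starting velocity `u^{1/2}` satisfies the discrete divergence constraint. -/
structure IsStaggeredRun (N : ℕ) (ν σ Δt : ℝ) (K : ℕ) (u : ℕ → VectorField ι)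
    (p w : ℕ → ScalarField ι) : Prop where
  velocity_mem : u 0 ∈ M.RT N
  vorticity_mem : w 0 ∈ M.CG N
  divergence : M.DiscreteDivConstraint N (u 0)
  step : ∀ k < K, M.IsStaggeredStep N ν σ Δt (u k) (w k) (u (k + 1)) (p (k + 1)) (w (k + 1))

/-- The implicit (unstaggered) midpoint step used to start the scheme: from `u = u^0`, `w = ω^0` to
`u' = u^1`, `w' = ω^1`, with total pressure `p` at the half step. -/
structure IsImplicitStep (N : ℕ) (ν σ Δt : ℝ) (u : VectorField ι) (w : ScalarField ι)
    (u' : VectorField ι) (p w' : ScalarField ι) : Prop where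
  velocity_mem : u' ∈ M.RT N
  pressure_mem : p ∈ M.DG (N - 1)
  vorticity_mem : w' ∈ M.CG N
  momentum : M.MomentumEquation N ν Δt u u' p ((1 / 2 : ℝ) • (w' + w))
  vorticity : M.VorticityEquation N ν σ Δt ((1 / 2 : ℝ) • (u' + u)) w w'
  divergence : M.DiscreteDivConstraint N u'

end PeriodicMesh

end

end MEEVC

/-!
Two facts carry the theorem.

The divergence of a Raviart-Thomas field of degree `N` is a piecewise polynomial of degree `N - 1`
(`div_mem_polyLE`), so it is itself an admissible test function in the discrete constraint. This
gives `∫ (∇ · u)² = 0`, hence `∇ · u = 0` on every triangle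
(`PeriodicMesh.DiscreteDivConstraint.pointwiseDivFree`).

A piecewise `C¹` field whose normal components match across the edges has total divergence zero
over a periodic mesh (`PeriodicMesh.sum_integral_divergence_eq_zero`). By the divergence theorem on
each triangle (`integral_divergence_triangle`, obtained from Fubini's theorem on a reference
triangle through the Piola transform), the total divergence is the sum of the outward fluxes through
all edges. Conformity provides each edge with a partner, and disjointness of interiors forces
the two triangles to lie on opposite sides of it, as triangles on the same side would overlap near
the midpoint of the edge (`exists_mem_interior_of_same_side`). So the partner is unique, partnership
is an involution, and partners carry opposite fluxes.

Applied to `φ u` with `φ` periodic, the second fact turns pointwise into weak divergence-freeness.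
Applied to `ω u` with `ω` in `CG_N`, it removes one of the two convective terms of the vorticity
equation tested with `ξ = 1`. The other one is tested against `∇ · u = 0`, and the diffusion term
contains `∇ × 1 = 0`, so only the difference of the total vorticities remains.
-/

namespace MEEVC

open MeasureTheory

/-! ### Polynomial fields -/

/-- The formal partial derivatives of a polynomial are those of its evaluation map. -/
theorem hasFDerivAt_eval (p : Poly) (x : Plane) :
    HasFDerivAt (fun y : Plane => MvPolynomial.eval y p)
      (∑ i, MvPolynomial.eval x (MvPolynomial.pderiv i p) •
        (ContinuousLinearMap.proj i : Plane →L[ℝ] ℝ)) x := by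
  induction p using MvPolynomial.induction_on with
  | C a => simpa using hasFDerivAt_const a x
  | add p q hp hq =>
    simp only [map_add, add_smul, Finset.sum_add_distrib]
    exact hp.add hq
  | mul_X p n hp =>
    have hX : HasFDerivAt (fun y : Plane => y n)
        (ContinuousLinearMap.proj n : Plane →L[ℝ] ℝ) x := hasFDerivAt_apply n x
    simp only [map_mul, MvPolynomial.eval_X]
    convert! hp.mul hX using 1
    ext v
    fin_cases n <;>
      simp [Fin.sum_univ_two, MvPolynomial.pderiv_X, Pi.single_apply] <;> ring

theorem contDiff_eval (p : Poly) (n : WithTop ℕ∞) :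
    ContDiff ℝ n (fun y : Plane => MvPolynomial.eval y p) :=
  (AnalyticOnNhd.eval_mvPolynomial p).contDiff

theorem fderiv_eval_apply (p : Poly) (x v : Plane) :
    fderiv ℝ (fun y : Plane => MvPolynomial.eval y p) x v
      = MvPolynomial.eval x (MvPolynomial.pderiv 0 p) * v 0
        + MvPolynomial.eval x (MvPolynomial.pderiv 1 p) * v 1 := by
  rw [(hasFDerivAt_eval p x).fderiv]
  simp [Fin.sum_univ_two]

theorem monomial_mem_polyLE {k : ℕ} {s : Fin 2 →₀ ℕ} (hs : s.degree ≤ k) (c : ℝ) :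
    MvPolynomial.monomial s c ∈ polyLE k := by
  rw [MvPolynomial.mem_restrictTotalDegree]
  exact (MvPolynomial.totalDegree_monomial_le s c).trans hs

/-- A linear operator that maps the monomials of degree at most `k` into polynomials of degree at
most `k` preserves `polyLE k`. -/
theorem map_mem_polyLE {k : ℕ} (L : Poly →ₗ[ℝ] Poly)
    (hL : ∀ (s : Fin 2 →₀ ℕ) (c : ℝ), s.degree ≤ k → L (MvPolynomial.monomial s c) ∈ polyLE k)
    {p : Poly} (hp : p ∈ polyLE k) : L p ∈ polyLE k := by
  rw [p.as_sum, map_sum]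
  refine Submodule.sum_mem _ fun s hs => hL s _ ?_
  exact (MvPolynomial.le_totalDegree hs).trans ((MvPolynomial.mem_restrictTotalDegree _ _ _).1 hp)

theorem pderiv_mem_polyLE {k : ℕ} (i : Fin 2) {p : Poly} (hp : p ∈ polyLE k) :
    MvPolynomial.pderiv i p ∈ polyLE k := by
  refine map_mem_polyLE (MvPolynomial.pderiv i : Derivation ℝ Poly Poly).toLinearMap
    (fun s c hs => ?_) hp
  change MvPolynomial.pderiv i (MvPolynomial.monomial s c) ∈ polyLE k
  rw [MvPolynomial.pderiv_monomial]
  exact monomial_mem_polyLE ((Finsupp.degree_mono tsub_le_self).trans hs) _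

theorem X_mul_pderiv_mem_polyLE {k : ℕ} (i : Fin 2) {p : Poly} (hp : p ∈ polyLE k) :
    MvPolynomial.X i * MvPolynomial.pderiv i p ∈ polyLE k := by
  refine map_mem_polyLE ((LinearMap.mulLeft ℝ (MvPolynomial.X i : Poly)).comp
    (MvPolynomial.pderiv i : Derivation ℝ Poly Poly).toLinearMap) (fun s c hs => ?_) hp
  change MvPolynomial.X i * MvPolynomial.pderiv i (MvPolynomial.monomial s c) ∈ polyLE k
  rw [MvPolynomial.X_mul_pderiv_monomial]
  exact Submodule.smul_of_tower_mem _ _ (monomial_mem_polyLE hs _)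

/-- The divergence maps the Raviart-Thomas space into polynomials of degree `N - 1`: although the
top part `x r` of the field has degree `N`, its divergence is `2 r + x · ∇r`. -/
theorem div_mem_polyLE {ι : Type*} {N : ℕ} {v : VectorField ι} {T : ι} (hv : v T ∈ localRT N) :
    div v T ∈ polyLE (N - 1) := by
  obtain ⟨q, r, hq, hr, h⟩ := hv
  have : div v T = MvPolynomial.pderiv 0 (q 0) + MvPolynomial.pderiv 1 (q 1) + (r + r)
      + (MvPolynomial.X 0 * MvPolynomial.pderiv 0 r
        + MvPolynomial.X 1 * MvPolynomial.pderiv 1 r) := by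
    simp only [div, h, map_add, Derivation.leibniz, MvPolynomial.pderiv_X_self, smul_eq_mul]
    ring
  rw [this]
  exact Submodule.add_mem _ (Submodule.add_mem _ (Submodule.add_mem _
    (pderiv_mem_polyLE 0 (hq 0)) (pderiv_mem_polyLE 1 (hq 1))) (Submodule.add_mem _ hr hr))
    (Submodule.add_mem _ (X_mul_pderiv_mem_polyLE 0 hr) (X_mul_pderiv_mem_polyLE 1 hr))

/-! ### Triangles -/

/-- Twice the signed area of the triangle `P Q R`, positive when it is traversed
counterclockwise. -/
def orient (P Q R : Plane) : ℝ := (Q 0 - P 0) * (R 1 - P 1) - (Q 1 - P 1) * (R 0 - P 0)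

theorem orient_swap (P Q R : Plane) : orient Q P R = -orient P Q R := by
  simp only [orient]; ring

theorem orient_add (P Q R s : Plane) : orient (P + s) (Q + s) (R + s) = orient P Q R := by
  simp only [orient, Pi.add_apply]; ring

theorem continuous_orient (P Q : Plane) : Continuous (orient P Q) := by
  unfold orient; fun_prop

/-- Each vertex sees the opposite edge with the orientation of the triangle. -/
theorem orient_opposite (a : Fin 3 → Plane) (i : Fin 3) :
    orient (a (i + 1)) (a (i + 2)) (a i) = orient (a 0) (a 1) (a 2) := by
  fin_cases i <;> simp [orient] <;> ring

theorem orient_ne_zero {a : Fin 3 → Plane} (ha : AffineIndependent ℝ a) :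
    orient (a 0) (a 1) (a 2) ≠ 0 := by
  intro h0
  have hli := (affineIndependent_iff.1 ha)
  -- collinear points satisfy these two affine relations, one for each coordinate `k`
  have key : ∀ (k : Fin 2) (i : Fin 3),
      (![a 1 k - a 2 k, a 2 k - a 0 k, a 0 k - a 1 k] : Fin 3 → ℝ) i = 0 := by
    intro k i
    refine hli Finset.univ _ ?_ ?_ i (Finset.mem_univ i)
    · simp [Fin.sum_univ_three]
    · simp only [orient] at h0
      ext j
      simp only [Fin.sum_univ_three, Pi.add_apply, Pi.smul_apply, smul_eq_mul, Pi.zero_apply,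
        Matrix.cons_val_zero, Matrix.cons_val_one, Matrix.cons_val_two,
        Matrix.head_cons, Matrix.tail_cons]
      fin_cases k <;> fin_cases j <;> simp only [Fin.zero_eta, Fin.mk_one, Fin.isValue] <;>
        first | (ring; done) | linear_combination h0 | linear_combination -h0
  have h01 : a 0 = a 1 := by
    ext k
    simpa [sub_eq_zero] using key k 2
  exact absurd (ha.injective h01) (by decide)

/-- A triangle is the image of the reference triangle under the affine parametrisation based at its
vertex `0`. -/
theorem mem_triangle_iff (a : Fin 3 → Plane) (x : Plane) :
    x ∈ triangle a ↔ ∃ s t : ℝ, 0 ≤ s ∧ 0 ≤ t ∧ s + t ≤ 1 ∧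
      x = a 0 + s • (a 1 - a 0) + t • (a 2 - a 0) := by
  constructor
  · intro hx
    have hr : Set.range a = {a 0, a 1, a 2} := by
      ext y
      simp [Set.mem_range, Fin.exists_fin_succ, eq_comm]
    rw [triangle, hr, convexHull_insert (Set.insert_nonempty _ _), convexHull_pair,
      mem_convexJoin] at hx
    obtain ⟨_, rfl, b, ⟨α, β, hα, hβ, hαβ, rfl⟩, ⟨γ, δ, hγ, hδ, hγδ, rfl⟩⟩ := hx
    refine ⟨δ * α, δ * β, by positivity, by positivity, ?_, ?_⟩
    · rw [← mul_add, hαβ]; linarith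
    · obtain rfl : γ = 1 - δ := by linarith
      obtain rfl : α = 1 - β := by linarith
      module
  · rintro ⟨s, t, hs, ht, hst, rfl⟩
    refine mem_convexHull_of_exists_fintype ![1 - s - t, s, t] a ?_ ?_
      (fun i => Set.mem_range_self i) ?_
    · intro i; fin_cases i <;> simp <;> linarith
    · simp only [Fin.sum_univ_three, Matrix.cons_val]; ring
    · simp [Fin.sum_univ_three]; module

theorem isCompact_triangle (a : Fin 3 → Plane) : IsCompact (triangle a) :=
  (Set.finite_range a).isCompact_convexHull ℝ

theorem edge_subset_triangle (a : Fin 3 → Plane) (i : Fin 3) :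
    segment ℝ (a (i + 1)) (a (i + 2)) ⊆ triangle a :=
  (convex_convexHull ℝ _).segment_subset (subset_convexHull ℝ _ ⟨_, rfl⟩)
    (subset_convexHull ℝ _ ⟨_, rfl⟩)

/-- A point that sees the three edges with the orientation of the triangle lies in its interior. -/
theorem mem_interior_triangle {a : Fin 3 → Plane} {x : Plane}
    (h : ∀ i : Fin 3, 0 < orient (a (i + 1)) (a (i + 2)) x * orient (a 0) (a 1) (a 2)) :
    x ∈ interior (triangle a) := by
  have hsub : {y | ∀ i : Fin 3, 0 < orient (a (i + 1)) (a (i + 2)) y * orient (a 0) (a 1) (a 2)}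
      ⊆ triangle a := by
    intro y hy
    set D := orient (a 0) (a 1) (a 2) with hD
    have hD0 : D ≠ 0 := fun h0 => by simpa [h0] using hy 0
    have hD2 : 0 < D * D := mul_self_pos.2 hD0
    -- Cramer's rule for the barycentric coordinates of `y`
    refine (mem_triangle_iff a y).2 ⟨orient (a 2) (a 0) y * D / (D * D),
      orient (a 0) (a 1) y * D / (D * D), (div_pos (hy 1) hD2).le, (div_pos (hy 2) hD2).le, ?_, ?_⟩
    · rw [← add_div, div_le_one hD2]
      have h0 : 0 < orient (a 1) (a 2) y * D := hy 0
      have : orient (a 1) (a 2) y + orient (a 2) (a 0) y + orient (a 0) (a 1) y = D := by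
        simp only [hD, orient]; ring
      linear_combination congrArg (· * D) this + h0.le
    · rw [mul_div_mul_right _ _ hD0, mul_div_mul_right _ _ hD0]
      ext k
      simp only [Pi.add_apply, Pi.smul_apply, Pi.sub_apply, smul_eq_mul]
      field_simp
      simp only [hD, orient]
      fin_cases k <;> simp <;> ring
  refine interior_maximal hsub ?_ h
  simp only [Set.ofPred_forall]
  exact isOpen_iInter_of_finite fun i =>
    isOpen_lt continuous_const ((continuous_orient _ _).mul continuous_const)

/-- A variant of `mem_interior_triangle` in which one edge is given by its unordered end points. -/
theorem mem_interior_triangle_of_edge {a : Fin 3 → Plane} {i : Fin 3} {P Q x : Plane}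
    (he : s(P, Q) = triangleEdge a i)
    (h1 : 0 < orient P Q x * orient P Q (a i)) (h2 : 0 < orient Q (a i) x * orient P Q (a i))
    (h3 : 0 < orient (a i) P x * orient P Q (a i)) : x ∈ interior (triangle a) := by
  -- exchanging the end points changes the sign of both factors in each product
  have key : 0 < orient (a (i + 1)) (a (i + 2)) x * orient (a (i + 1)) (a (i + 2)) (a i) ∧
      0 < orient (a (i + 2)) (a i) x * orient (a (i + 1)) (a (i + 2)) (a i) ∧
      0 < orient (a i) (a (i + 1)) x * orient (a (i + 1)) (a (i + 2)) (a i) := by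
    rcases Sym2.eq_iff.1 he with ⟨rfl, rfl⟩ | ⟨rfl, rfl⟩
    · exact ⟨h1, h2, h3⟩
    · refine ⟨?_, ?_, ?_⟩
      · rw [orient_swap, orient_swap (a (i + 2))]; linarith
      · rw [orient_swap (a i), orient_swap (a (i + 2)) (a (i + 1)) (a i)]; linarith
      · rw [orient_swap (a (i + 1)) (a i), orient_swap (a (i + 2)) (a (i + 1)) (a i)]; linarith
  rw [orient_opposite] at key
  refine mem_interior_triangle fun j => ?_
  obtain ⟨k1, k2, k3⟩ := key
  fin_cases i <;> fin_cases j <;> assumption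

theorem interior_triangle_nonempty {a : Fin 3 → Plane} (ha : orient (a 0) (a 1) (a 2) ≠ 0) :
    (interior (triangle a)).Nonempty := by
  refine ⟨(1 / 3 : ℝ) • (a 0 + a 1 + a 2), mem_interior_triangle fun i => ?_⟩
  have h : orient (a (i + 1)) (a (i + 2)) ((1 / 3 : ℝ) • (a 0 + a 1 + a 2))
      = orient (a 0) (a 1) (a 2) / 3 := by
    fin_cases i <;> simp [orient] <;> ring
  rw [h]
  have : 0 < orient (a 0) (a 1) (a 2) * orient (a 0) (a 1) (a 2) := mul_self_pos.2 ha
  linarith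

theorem triangle_subset_closure_interior {a : Fin 3 → Plane} (ha : orient (a 0) (a 1) (a 2) ≠ 0) :
    triangle a ⊆ closure (interior (triangle a)) := by
  rw [triangle, (convex_convexHull ℝ (Set.range a)).closure_interior_eq_closure_of_nonempty_interior
    (interior_triangle_nonempty ha)]
  exact subset_closure

/-- Two triangles which lie on the same side of a common edge (up to the translation `s`) overlap:
the points close to the midpoint of the edge, in the direction of a vertex opposite to it, are
interior to both. -/
theorem exists_mem_interior_of_same_side {a b : Fin 3 → Plane} {i j : Fin 3} {P Q s : Plane}
    (ha : s(P, Q) = triangleEdge a i) (hb : s(P + s, Q + s) = triangleEdge b j)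
    (hside : 0 < orient P Q (a i) * orient (P + s) (Q + s) (b j)) :
    ∃ x ∈ interior (triangle a), x + s ∈ interior (triangle b) := by
  obtain ⟨R, hR⟩ : ∃ R, R + s = b j := ⟨b j - s, by simp⟩
  rw [← hR, orient_add] at hside
  set A := a i
  have hDa : 0 < orient P Q A * orient P Q A := by
    exact mul_self_pos.2 fun h => by simp [h] at hside
  have hDb : 0 < orient P Q R * orient P Q R := by
    exact mul_self_pos.2 fun h => by simp [h] at hside
  let y : ℝ → Plane := fun ε => (1 / 2 : ℝ) • (P + Q) + ε • (R - (1 / 2 : ℝ) • (P + Q))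
  have hy : Continuous y := by fun_prop
  have ev : ∀ (U V : Plane) (c : ℝ), 0 < orient U V (y 0) * c →
      ∀ᶠ ε in nhdsWithin (0 : ℝ) (Set.Ioi 0), 0 < orient U V (y ε) * c := fun U V c h =>
    nhdsWithin_le_nhds (((((continuous_orient U V).comp hy).mul
      continuous_const).tendsto 0).eventually (lt_mem_nhds h))
  have hPQ : ∀ ε, orient P Q (y ε) = ε * orient P Q R := fun ε => by
    simp only [y, orient, Pi.add_apply, Pi.smul_apply, Pi.sub_apply, smul_eq_mul]; ring
  have h1 : ∀ C, orient Q C (y 0) = orient P Q C / 2 := fun C => by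
    simp only [y, orient, Pi.add_apply, Pi.smul_apply, Pi.sub_apply, smul_eq_mul]; ring
  have h2 : ∀ C, orient C P (y 0) = orient P Q C / 2 := fun C => by
    simp only [y, orient, Pi.add_apply, Pi.smul_apply, Pi.sub_apply, smul_eq_mul]; ring
  obtain ⟨ε, hε, e1, e2, e3, e4⟩ := (eventually_mem_nhdsWithin.and
    ((ev Q A (orient P Q A) (by rw [h1]; linarith)).and
    ((ev A P (orient P Q A) (by rw [h2]; linarith)).and
    ((ev Q R (orient P Q R) (by rw [h1]; linarith)).and
    (ev R P (orient P Q R) (by rw [h2]; linarith)))))).exists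
  have hε' : 0 < ε := hε
  refine ⟨y ε, mem_interior_triangle_of_edge ha ?_ e1 e2, mem_interior_triangle_of_edge hb ?_ ?_ ?_⟩
  · change 0 < orient P Q (y ε) * orient P Q A
    rw [hPQ, mul_assoc, mul_comm (orient P Q R)]; positivity
  · rw [← hR, orient_add, orient_add, hPQ, mul_assoc]; positivity
  · rw [← hR, orient_add, orient_add]; exact e3
  · rw [← hR, orient_add, orient_add]; exact e4

/-! ### The divergence theorem on a triangle -/

/-- The triangle with vertices `(0, 0)`, `(1, 0)`, `(0, 1)`. -/
def refTriangle : Set Plane := {y | 0 ≤ y 0 ∧ 0 ≤ y 1 ∧ y 0 + y 1 ≤ 1}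

theorem isClosed_refTriangle : IsClosed refTriangle :=
  (isClosed_le continuous_const (continuous_apply 0)).inter
    ((isClosed_le continuous_const (continuous_apply 1)).inter
      (isClosed_le ((continuous_apply 0).add (continuous_apply 1)) continuous_const))

theorem integral_eq_integral_slices {f : ℝ → ℝ} (g : ℝ → ℝ → ℝ)
    (h : ∀ s, f s = if 0 ≤ s ∧ s ≤ 1 then ∫ t in (0 : ℝ)..(1 - s), g s t else 0) :
    ∫ s, f s = ∫ s in (0 : ℝ)..1, ∫ t in (0 : ℝ)..(1 - s), g s t := by
  rw [intervalIntegral.integral_of_le zero_le_one, ← integral_Icc_eq_integral_Ioc,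
    ← integral_indicator measurableSet_Icc]
  congr 1
  ext s
  rw [h, Set.indicator_apply]
  rfl

theorem integral_indicator_slice (s : ℝ) (g : ℝ → ℝ) :
    (∫ t, if 0 ≤ s ∧ 0 ≤ t ∧ s + t ≤ 1 then g t else 0)
      = if 0 ≤ s ∧ s ≤ 1 then ∫ t in (0 : ℝ)..(1 - s), g t else 0 := by
  split_ifs with hs
  · rw [intervalIntegral.integral_of_le (by linarith), ← integral_Icc_eq_integral_Ioc,
      ← integral_indicator measurableSet_Icc]
    congr 1
    ext t
    rw [Set.indicator_apply]
    refine if_congr ?_ rfl rfl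
    rw [Set.mem_Icc]
    constructor
    · rintro ⟨-, h1, h2⟩; exact ⟨h1, by linarith⟩
    · rintro ⟨h1, h2⟩; exact ⟨hs.1, h1, by linarith⟩
  · refine (congrArg _ (funext fun t => if_neg ?_)).trans (integral_zero ℝ ℝ)
    rintro ⟨h1, h2, h3⟩
    exact hs ⟨h1, by linarith⟩

/-- Fubini's theorem on the reference triangle, in both orders. -/
theorem integral_refTriangle {h : Plane → ℝ} (hh : Continuous h) :
    ∫ y in refTriangle, h y = ∫ s in (0 : ℝ)..1, ∫ t in (0 : ℝ)..(1 - s), h ![s, t] ∧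
    ∫ y in refTriangle, h y = ∫ t in (0 : ℝ)..1, ∫ s in (0 : ℝ)..(1 - t), h ![s, t] := by
  let S : Set (ℝ × ℝ) := {p | 0 ≤ p.1 ∧ 0 ≤ p.2 ∧ p.1 + p.2 ≤ 1}
  have hS : MeasurableSet S := ((isClosed_le continuous_const continuous_fst).inter
    ((isClosed_le continuous_const continuous_snd).inter
      (isClosed_le (continuous_fst.add continuous_snd) continuous_const))).measurableSet
  let g : ℝ × ℝ → ℝ := fun p => h ![p.1, p.2]
  have hg : Continuous g := by
    refine hh.comp (continuous_pi fun i => ?_)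
    fin_cases i
    · exact continuous_fst
    · exact continuous_snd
  have hgi : Integrable (S.indicator g) := by
    rw [integrable_indicator_iff hS]
    refine (hg.continuousOn.integrableOn_compact (isCompact_Icc (a := (0, 0)) (b := (1, 1)))).mono_set
      ?_
    rintro ⟨s, t⟩ ⟨h1, h2, h3⟩
    simp only at h1 h2 h3
    exact ⟨⟨h1, h2⟩, ⟨by simp only; linarith, by simp only; linarith⟩⟩
  have e : ∫ y in refTriangle, h y = ∫ p, S.indicator g p := by
    rw [← integral_indicator isClosed_refTriangle.measurableSet,
      ← (volume_preserving_finTwoArrow ℝ).integral_comp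
        (MeasurableEquiv.finTwoArrow.measurableEmbedding)]
    congr 1
    ext y
    classical
    have hy : ![y 0, y 1] = y := by ext i; fin_cases i <;> rfl
    have : g (MeasurableEquiv.finTwoArrow y) = h y := congrArg h hy
    rw [Set.indicator_apply, Set.indicator_apply, this]
    exact if_congr Iff.rfl rfl rfl
  have hpt : ∀ s t, S.indicator g (s, t) = if 0 ≤ s ∧ 0 ≤ t ∧ s + t ≤ 1 then h ![s, t] else 0 :=
    fun s t => by
      classical
      rw [Set.indicator_apply]
      exact if_congr Iff.rfl rfl rfl
  constructor
  · rw [e, Measure.volume_eq_prod, integral_prod _ hgi]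
    refine integral_eq_integral_slices (fun s t => h ![s, t]) fun s => ?_
    simp only [hpt]
    exact integral_indicator_slice s _
  · rw [e, Measure.volume_eq_prod, integral_prod_symm _ hgi]
    refine integral_eq_integral_slices (fun t s => h ![s, t]) fun t => ?_
    simp only [hpt]
    rw [← integral_indicator_slice t]
    congr 1
    ext s
    refine if_congr ?_ rfl rfl
    rw [add_comm s t]
    tauto

/-- The flux of the field `F` through the segment from `P` to `Q`, towards the right-hand side. -/
noncomputable def flux (F : Fin 2 → Plane → ℝ) (P Q : Plane) : ℝ :=
  ∫ t in (0 : ℝ)..1, (F 0 (P + t • (Q - P)) * (Q 1 - P 1) - F 1 (P + t • (Q - P)) * (Q 0 - P 0))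

theorem flux_swap (F : Fin 2 → Plane → ℝ) (P Q : Plane) : flux F Q P = -flux F P Q := by
  have h := intervalIntegral.integral_comp_sub_left (a := 0) (b := 1)
    (fun t : ℝ => F 0 (P + t • (Q - P)) * (Q 1 - P 1) - F 1 (P + t • (Q - P)) * (Q 0 - P 0)) 1
  rw [sub_self, sub_zero] at h
  rw [flux, flux, ← h, ← intervalIntegral.integral_neg]
  congr 1
  ext t
  rw [show P + (1 - t) • (Q - P) = Q + t • (P - Q) by module]
  ring

/-- The divergence of a vector field given by its components. -/
noncomputable def divergence (F : Fin 2 → Plane → ℝ) (x : Plane) : ℝ :=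
  fderiv ℝ (F 0) x ![1, 0] + fderiv ℝ (F 1) x ![0, 1]

/-- The divergence theorem on the reference triangle. -/
theorem integral_divergence_refTriangle {G : Fin 2 → Plane → ℝ} (hG : ∀ j, ContDiff ℝ 1 (G j)) :
    ∫ y in refTriangle, divergence G y
      = flux G ![0, 0] ![1, 0] + flux G ![1, 0] ![0, 1] + flux G ![0, 1] ![0, 0] := by
  have hc : ∀ j (v : Plane), Continuous fun y => fderiv ℝ (G j) y v := fun j v =>
    ((hG j).continuous_fderiv one_ne_zero).clm_apply continuous_const
  have hI : ∀ j (v : Plane), IntegrableOn (fun y => fderiv ℝ (G j) y v) refTriangle := by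
    intro j v
    refine ((hc j v).continuousOn.integrableOn_compact (isCompact_Icc (a := 0) (b := 1))).mono_set ?_
    rintro y ⟨h1, h2, h3⟩
    exact ⟨Fin.forall_fin_two.2 ⟨h1, h2⟩, Fin.forall_fin_two.2
      ⟨by simp only [Pi.one_apply]; linarith, by simp only [Pi.one_apply]; linarith⟩⟩
  have hl : ∀ j (γ : ℝ → Plane) (v : Plane), (∀ s, HasDerivAt γ v s) →
      ∀ b : ℝ, ∫ s in (0 : ℝ)..b, fderiv ℝ (G j) (γ s) v = G j (γ b) - G j (γ 0) := by
    intro j γ v hγ b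
    have hγc : Continuous γ := continuous_iff_continuousAt.2 fun s => (hγ s).continuousAt
    refine intervalIntegral.integral_eq_sub_of_hasDerivAt (f := fun s => G j (γ s)) (fun s _ => ?_)
      (((hc j v).comp hγc).intervalIntegrable _ _)
    exact (((hG j).differentiable one_ne_zero (γ s)).hasFDerivAt).comp_hasDerivAt s (hγ s)
  have d0 : ∀ t s : ℝ, HasDerivAt (fun s : ℝ => (![s, t] : Plane)) ![1, 0] s := fun t s => by
    refine hasDerivAt_pi.2 fun i => ?_
    fin_cases i
    · exact hasDerivAt_id s
    · exact hasDerivAt_const s t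
  have d1 : ∀ s t : ℝ, HasDerivAt (fun t : ℝ => (![s, t] : Plane)) ![0, 1] t := fun s t => by
    refine hasDerivAt_pi.2 fun i => ?_
    fin_cases i
    · exact hasDerivAt_const t s
    · exact hasDerivAt_id t
  have hGc : ∀ j (a b c d : ℝ), IntervalIntegrable
      (fun t : ℝ => G j ![a + b * t, c + d * t]) volume 0 1 := fun j a b c d => by
    refine ((hG j).continuous.comp (continuous_pi fun i => ?_)).intervalIntegrable _ _
    fin_cases i
    · exact continuous_const.add (continuous_const.mul continuous_id)
    · exact continuous_const.add (continuous_const.mul continuous_id)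
  have e0 : ∫ y in refTriangle, fderiv ℝ (G 0) y ![1, 0]
      = ∫ t in (0 : ℝ)..1, (G 0 ![1 + (-1) * t, 0 + 1 * t] - G 0 ![0 + 0 * t, 0 + 1 * t]) := by
    rw [(integral_refTriangle (hc 0 _)).2]
    congr 1
    ext t
    rw [hl 0 (fun s => ![s, t]) _ (d0 t)]
    ring_nf
  have e1 : ∫ y in refTriangle, fderiv ℝ (G 1) y ![0, 1]
      = ∫ s in (0 : ℝ)..1, (G 1 ![0 + 1 * s, 1 + (-1) * s] - G 1 ![0 + 1 * s, 0 + 0 * s]) := by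
    rw [(integral_refTriangle (hc 1 _)).1]
    congr 1
    ext s
    rw [hl 1 (fun t => ![s, t]) _ (d1 s)]
    ring_nf
  -- reverse the hypotenuse, so that both edge integrals run along it in the same direction
  have e1' : ∫ s in (0 : ℝ)..1, G 1 ![0 + 1 * s, 1 + (-1) * s]
      = ∫ s in (0 : ℝ)..1, G 1 ![1 + (-1) * s, 0 + 1 * s] := by
    have h := intervalIntegral.integral_comp_sub_left (a := 0) (b := 1)
      (fun s : ℝ => G 1 ![0 + 1 * s, 1 + (-1) * s]) 1
    rw [sub_self, sub_zero] at h
    rw [← h]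
    congr 1
    ext s
    ring_nf
  have f1 : flux G ![0, 0] ![1, 0] = -∫ s in (0 : ℝ)..1, G 1 ![0 + 1 * s, 0 + 0 * s] := by
    rw [flux, ← intervalIntegral.integral_neg]
    congr 1; ext t; simp
  have f2 : flux G ![1, 0] ![0, 1] = (∫ s in (0 : ℝ)..1, G 0 ![1 + (-1) * s, 0 + 1 * s])
      + ∫ s in (0 : ℝ)..1, G 1 ![1 + (-1) * s, 0 + 1 * s] := by
    rw [flux, ← intervalIntegral.integral_add (hGc _ _ _ _ _) (hGc _ _ _ _ _)]
    congr 1; ext t; simp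
  have f3 : flux G ![0, 1] ![0, 0] = -∫ t in (0 : ℝ)..1, G 0 ![0 + 0 * t, 0 + 1 * t] := by
    rw [flux_swap, flux]
    congr 2; ext t; simp
  unfold divergence
  rw [integral_add (hI 0 _) (hI 1 _), e0, e1,
    intervalIntegral.integral_sub (hGc _ _ _ _ _) (hGc _ _ _ _ _),
    intervalIntegral.integral_sub (hGc _ _ _ _ _) (hGc _ _ _ _ _), e1', f1, f2, f3]
  ring

/-- The affine map from the reference triangle onto the triangle with vertices `a`. -/
noncomputable def fromRef (a : Fin 3 → Plane) (y : Plane) : Plane :=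
  a 0 + y 0 • (a 1 - a 0) + y 1 • (a 2 - a 0)

/-- The linear part of `fromRef`. -/
noncomputable def fromRefLinear (a : Fin 3 → Plane) : Plane →L[ℝ] Plane :=
  (ContinuousLinearMap.proj 0 : Plane →L[ℝ] ℝ).smulRight (a 1 - a 0)
    + (ContinuousLinearMap.proj 1 : Plane →L[ℝ] ℝ).smulRight (a 2 - a 0)

theorem fromRefLinear_apply (a : Fin 3 → Plane) (v : Plane) :
    fromRefLinear a v = v 0 • (a 1 - a 0) + v 1 • (a 2 - a 0) := rfl

theorem hasFDerivAt_fromRef (a : Fin 3 → Plane) (y : Plane) :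
    HasFDerivAt (fromRef a) (fromRefLinear a) y := by
  have : fromRef a = fun y => a 0 + fromRefLinear a y := by
    ext1 y; rw [fromRefLinear_apply, ← add_assoc]; rfl
  rw [this]
  exact (fromRefLinear a).hasFDerivAt.const_add _

theorem det_fromRefLinear (a : Fin 3 → Plane) :
    (fromRefLinear a).det = orient (a 0) (a 1) (a 2) := by
  rw [ContinuousLinearMap.det, ← LinearMap.det_toMatrix', Matrix.det_fin_two]
  simp [LinearMap.toMatrix'_apply, fromRefLinear_apply, orient]
  ring

theorem image_fromRef (a : Fin 3 → Plane) : fromRef a '' refTriangle = triangle a := by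
  ext x
  rw [mem_triangle_iff]
  constructor
  · rintro ⟨y, ⟨h1, h2, h3⟩, rfl⟩
    exact ⟨y 0, y 1, h1, h2, h3, rfl⟩
  · rintro ⟨s, t, h1, h2, h3, rfl⟩
    exact ⟨![s, t], ⟨h1, h2, h3⟩, rfl⟩

theorem fromRef_injective {a : Fin 3 → Plane} (ha : orient (a 0) (a 1) (a 2) ≠ 0) :
    Function.Injective (fromRef a) := by
  intro y z h
  have h0 := congrFun h 0
  have h1 := congrFun h 1
  simp only [fromRef, Pi.add_apply, Pi.smul_apply, Pi.sub_apply, smul_eq_mul] at h0 h1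
  have e0 : orient (a 0) (a 1) (a 2) * (y 0 - z 0) = 0 := by
    simp only [orient]
    linear_combination (a 2 1 - a 0 1) * h0 - (a 2 0 - a 0 0) * h1
  have e1 : orient (a 0) (a 1) (a 2) * (y 1 - z 1) = 0 := by
    simp only [orient]
    linear_combination -(a 1 1 - a 0 1) * h0 + (a 1 0 - a 0 0) * h1
  ext i
  fin_cases i
  · exact sub_eq_zero.1 ((mul_eq_zero.1 e0).resolve_left ha)
  · exact sub_eq_zero.1 ((mul_eq_zero.1 e1).resolve_left ha)

/-- The Piola transform of the field `F`: the pull-back to the reference triangle for which fluxes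
are preserved and the divergence is multiplied by the Jacobian. -/
noncomputable def piola (a : Fin 3 → Plane) (F : Fin 2 → Plane → ℝ) : Fin 2 → Plane → ℝ :=
  ![fun y => (a 2 1 - a 0 1) * F 0 (fromRef a y) - (a 2 0 - a 0 0) * F 1 (fromRef a y),
    fun y => -(a 1 1 - a 0 1) * F 0 (fromRef a y) + (a 1 0 - a 0 0) * F 1 (fromRef a y)]

theorem contDiff_piola (a : Fin 3 → Plane) {F : Fin 2 → Plane → ℝ}
    (hF : ∀ j, ContDiff ℝ 1 (F j)) (j : Fin 2) : ContDiff ℝ 1 (piola a F j) := by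
  have hr : ContDiff ℝ 1 (fromRef a) := by unfold fromRef; fun_prop
  have h : ∀ j, ContDiff ℝ 1 (fun y => F j (fromRef a y)) := fun j => (hF j).comp hr
  fin_cases j
  · exact (contDiff_const.mul (h 0)).sub (contDiff_const.mul (h 1))
  · exact (contDiff_const.mul (h 0)).add (contDiff_const.mul (h 1))

theorem divergence_piola (a : Fin 3 → Plane) {F : Fin 2 → Plane → ℝ}
    (hF : ∀ j, ContDiff ℝ 1 (F j)) (y : Plane) :
    divergence (piola a F) y = orient (a 0) (a 1) (a 2) * divergence F (fromRef a y) := by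
  have h : ∀ j, HasFDerivAt (fun y => F j (fromRef a y))
      ((fderiv ℝ (F j) (fromRef a y)).comp (fromRefLinear a)) y := fun j =>
    (((hF j).differentiable one_ne_zero _).hasFDerivAt).comp y (hasFDerivAt_fromRef a y)
  have h0 : HasFDerivAt (piola a F 0) _ y :=
    ((h 0).const_mul (a 2 1 - a 0 1)).sub ((h 1).const_mul (a 2 0 - a 0 0))
  have h1 : HasFDerivAt (piola a F 1) _ y :=
    ((h 0).const_mul (-(a 1 1 - a 0 1))).add ((h 1).const_mul (a 1 0 - a 0 0))
  have hv : ∀ v : Plane, v = v 0 • ![1, 0] + v 1 • ![0, 1] := fun v => by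
    ext i; fin_cases i <;> simp
  have hL : ∀ (L : Plane →L[ℝ] ℝ) (v : Plane), L v = v 0 * L ![1, 0] + v 1 * L ![0, 1] :=
    fun L v => by
      conv_lhs => rw [hv v]
      simp only [map_add, map_smul, smul_eq_mul]
  rw [divergence, divergence, h0.fderiv, h1.fderiv]
  simp only [sub_apply, add_apply,
    smul_apply, ContinuousLinearMap.comp_apply, fromRefLinear_apply,
    smul_eq_mul, orient, Matrix.cons_val_zero, Matrix.cons_val_one, one_smul, zero_smul, add_zero,
    zero_add]
  rw [hL _ (a 1 - a 0), hL _ (a 2 - a 0), hL (fderiv ℝ (F 1) _) (a 1 - a 0),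
    hL (fderiv ℝ (F 1) _) (a 2 - a 0)]
  simp only [Pi.sub_apply]
  ring

theorem flux_piola (a : Fin 3 → Plane) (F : Fin 2 → Plane → ℝ) (p q : Plane) :
    flux (piola a F) p q = flux F (fromRef a p) (fromRef a q) := by
  unfold flux
  congr 1
  ext t
  have : fromRef a (p + t • (q - p)) = fromRef a p + t • (fromRef a q - fromRef a p) := by
    simp only [fromRef, Pi.add_apply, Pi.smul_apply, Pi.sub_apply, smul_eq_mul]
    module
  simp only [piola, Matrix.cons_val_zero, Matrix.cons_val_one, this]
  simp only [fromRef, Pi.add_apply, Pi.smul_apply, Pi.sub_apply, smul_eq_mul]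
  ring

/-- The outward flux of `F` through the edge of the triangle `a` opposite to the vertex `i`. -/
noncomputable def outwardFlux (a : Fin 3 → Plane) (F : Fin 2 → Plane → ℝ) (i : Fin 3) : ℝ :=
  Real.sign (orient (a 0) (a 1) (a 2)) * flux F (a (i + 1)) (a (i + 2))

/-- The divergence theorem on a triangle. -/
theorem integral_divergence_triangle {a : Fin 3 → Plane} (ha : orient (a 0) (a 1) (a 2) ≠ 0)
    {F : Fin 2 → Plane → ℝ} (hF : ∀ j, ContDiff ℝ 1 (F j)) :
    ∫ x in triangle a, divergence F x = ∑ i, outwardFlux a F i := by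
  have h1 : ∫ x in triangle a, divergence F x
      = Real.sign (orient (a 0) (a 1) (a 2)) * ∫ y in refTriangle, divergence (piola a F) y := by
    rw [← image_fromRef, integral_image_eq_integral_abs_det_fderiv_smul volume
      isClosed_refTriangle.measurableSet
      (fun y _ => (hasFDerivAt_fromRef a y).hasFDerivWithinAt) (fromRef_injective ha).injOn,
      ← integral_const_mul]
    congr 1
    ext y
    rw [det_fromRefLinear, divergence_piola a hF, smul_eq_mul, ← mul_assoc]
    rcases lt_or_gt_of_ne ha with h | h
    · rw [abs_of_neg h, Real.sign_of_neg h, neg_one_mul]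
    · rw [abs_of_pos h, Real.sign_of_pos h, one_mul]
  have v0 : fromRef a ![0, 0] = a 0 := by simp [fromRef]
  have v1 : fromRef a ![1, 0] = a 1 := by simp [fromRef]
  have v2 : fromRef a ![0, 1] = a 2 := by simp [fromRef]
  rw [h1, integral_divergence_refTriangle (contDiff_piola a hF), flux_piola, flux_piola, flux_piola,
    v0, v1, v2, Fin.sum_univ_three]
  simp only [outwardFlux]
  rw [show (0 : Fin 3) + 1 = 1 from rfl, show (0 : Fin 3) + 2 = 2 from rfl,
    show (1 : Fin 3) + 1 = 2 from rfl, show (1 : Fin 3) + 2 = 0 from rfl,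
    show (2 : Fin 3) + 1 = 0 from rfl, show (2 : Fin 3) + 2 = 1 from rfl]
  ring

/-! ### Cancellation of fluxes across the edges of the mesh -/

namespace PeriodicMesh

variable {ι : Type*} (M : PeriodicMesh ι)

theorem shift_sub (m m' : Fin 2 → ℤ) : M.shift (m - m') = M.shift m - M.shift m' := by
  simp only [shift, latticeShift, Fin.sum_univ_two, Pi.sub_apply, Int.cast_sub]
  module

theorem shift_neg (m : Fin 2 → ℤ) : M.shift (-m) = -M.shift m := by
  simp only [shift, latticeShift, Fin.sum_univ_two, Pi.neg_apply, Int.cast_neg]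
  module

theorem orient_vert_ne_zero (T : ι) : orient (M.vert T 0) (M.vert T 1) (M.vert T 2) ≠ 0 :=
  orient_ne_zero (M.nondegenerate T)

theorem edge_injective (T : ι) : Function.Injective (M.edge T) := by
  intro i j h
  have hinj := (M.nondegenerate T).injective
  rcases Sym2.eq_iff.1 h with ⟨h1, -⟩ | ⟨h1, h2⟩
  · exact add_right_cancel (hinj h1)
  · have e1 := hinj h1
    have e2 := hinj h2
    clear h h1 h2 hinj
    decide +revert

/-- The edge `p.2` of the triangle `p.1` coincides, after the translation with integer coordinates
`m`, with the edge `q.2` of `q.1`, and the two triangles are different copies. -/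
def EdgeMatch (p q : ι × Fin 3) (m : Fin 2 → ℤ) : Prop :=
  ¬ (q.1 = p.1 ∧ m = 0) ∧ (M.edge p.1 p.2).map (fun x => x + M.shift m) = M.edge q.1 q.2

variable {M}

theorem EdgeMatch.symm {p q : ι × Fin 3} {m : Fin 2 → ℤ} (h : M.EdgeMatch p q m) :
    M.EdgeMatch q p (-m) := by
  refine ⟨fun h' => h.1 ⟨h'.1.symm, neg_eq_zero.1 h'.2⟩, ?_⟩
  rw [← h.2, Sym2.map_map]
  have : ((fun x => x + M.shift (-m)) ∘ fun x => x + M.shift m) = id := by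
    ext x
    simp [shift_neg]
  rw [this, Sym2.map_id, id]

/-- Matching triangles lie on opposite sides of their common edge. -/
theorem EdgeMatch.orient_mul_neg {p q : ι × Fin 3} {m : Fin 2 → ℤ} (h : M.EdgeMatch p q m) :
    orient (M.vert p.1 (p.2 + 1)) (M.vert p.1 (p.2 + 2)) (M.vert p.1 p.2) *
      orient (M.vert p.1 (p.2 + 1) + M.shift m) (M.vert p.1 (p.2 + 2) + M.shift m)
        (M.vert q.1 q.2) < 0 := by
  have he : s(M.vert p.1 (p.2 + 1) + M.shift m, M.vert p.1 (p.2 + 2) + M.shift m)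
      = triangleEdge (M.vert q.1) q.2 := h.2
  have h1 : orient (M.vert p.1 (p.2 + 1)) (M.vert p.1 (p.2 + 2)) (M.vert p.1 p.2) ≠ 0 := by
    rw [orient_opposite]; exact M.orient_vert_ne_zero _
  have h2 : orient (M.vert p.1 (p.2 + 1) + M.shift m) (M.vert p.1 (p.2 + 2) + M.shift m)
        (M.vert q.1 q.2) ≠ 0 := by
    rcases Sym2.eq_iff.1 he with ⟨e1, e2⟩ | ⟨e1, e2⟩
    · rw [e1, e2, orient_opposite]; exact M.orient_vert_ne_zero _
    · rw [e1, e2, orient_swap, orient_opposite]; exact neg_ne_zero.2 (M.orient_vert_ne_zero _)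
  refine lt_of_le_of_ne (not_lt.1 fun hpos => ?_) (mul_ne_zero h1 h2)
  obtain ⟨x, hx, hx'⟩ := exists_mem_interior_of_same_side rfl he hpos
  obtain ⟨hT, hm⟩ := M.disjoint _ _ m x hx hx'
  exact h.1 ⟨hT.symm, hm⟩

/-- An edge matches only one other edge: two triangles matching it would lie on the same side of
it, and so overlap. -/
theorem EdgeMatch.unique {p q q' : ι × Fin 3} {m m' : Fin 2 → ℤ} (h : M.EdgeMatch p q m)
    (h' : M.EdgeMatch p q' m') : q = q' := by
  have e : s(M.vert p.1 (p.2 + 1) + M.shift m, M.vert p.1 (p.2 + 2) + M.shift m)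
      = triangleEdge (M.vert q.1) q.2 := h.2
  have e' : s(M.vert p.1 (p.2 + 1) + M.shift m', M.vert p.1 (p.2 + 2) + M.shift m')
      = triangleEdge (M.vert q'.1) q'.2 := h'.2
  have hs : ∀ P : Plane, P + M.shift m' = P + M.shift m + M.shift (m' - m) := fun P => by
    rw [shift_sub]; abel
  have o := h.orient_mul_neg
  have o' := h'.orient_mul_neg
  rw [hs, hs (M.vert p.1 (p.2 + 2))] at e' o'
  have hside : 0 < orient (M.vert p.1 (p.2 + 1) + M.shift m)
      (M.vert p.1 (p.2 + 2) + M.shift m) (M.vert q.1 q.2) * orient (M.vert p.1 (p.2 + 1) +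
      M.shift m + M.shift (m' - m)) (M.vert p.1 (p.2 + 2) + M.shift m + M.shift (m' - m))
      (M.vert q'.1 q'.2) := by
    rcases mul_neg_iff.1 o with ⟨h1, h2⟩ | ⟨h1, h2⟩
    · exact mul_pos_of_neg_of_neg h2 (neg_of_mul_neg_right o' h1.le)
    · exact mul_pos h2 (pos_of_mul_neg_right o' h1.le)
  obtain ⟨x, hx, hx'⟩ := exists_mem_interior_of_same_side e e' hside
  obtain ⟨hT, hm⟩ := M.disjoint _ _ (m' - m) x hx hx'
  obtain rfl : m' = m := sub_eq_zero.1 hm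
  obtain ⟨T, i⟩ := q
  obtain ⟨T', i'⟩ := q'
  obtain rfl : T = T' := hT
  have := M.edge_injective T (h.2.symm.trans h'.2)
  simp only at this
  rw [this]

variable (M)

/-- The normal components of the piecewise field `F` agree across every edge shared, modulo
periods, by two triangles. -/
def NormalContinuous (F : ι → Fin 2 → Plane → ℝ) : Prop :=
  ∀ (T T' : ι) (i i' : Fin 3) (m : Fin 2 → ℤ),
    (M.edge T i).map (fun x => x + M.shift m) = M.edge T' i' →
    ∀ x ∈ M.edgeSegment T i,
      F T 0 x * M.edgeNormal T i 0 + F T 1 x * M.edgeNormal T i 1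
        = F T' 0 (x + M.shift m) * M.edgeNormal T i 0 + F T' 1 (x + M.shift m) * M.edgeNormal T i 1

variable {M}

/-- Matching edges carry opposite outward fluxes: either their directions or the orientations of the
two triangles are opposite, but not both. -/
theorem EdgeMatch.outwardFlux_add {F : ι → Fin 2 → Plane → ℝ} (hF : M.NormalContinuous F)
    {p q : ι × Fin 3} {m : Fin 2 → ℤ} (h : M.EdgeMatch p q m) :
    outwardFlux (M.vert p.1) (F p.1) p.2 + outwardFlux (M.vert q.1) (F q.1) q.2 = 0 := by
  have he : s(M.vert p.1 (p.2 + 1) + M.shift m, M.vert p.1 (p.2 + 2) + M.shift m)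
      = triangleEdge (M.vert q.1) q.2 := h.2
  have hneg := h.orient_mul_neg
  have hflux : flux (F p.1) (M.vert p.1 (p.2 + 1)) (M.vert p.1 (p.2 + 2))
      = flux (F q.1) (M.vert p.1 (p.2 + 1) + M.shift m) (M.vert p.1 (p.2 + 2) + M.shift m) := by
    refine intervalIntegral.integral_congr fun t ht => ?_
    rw [Set.uIcc_of_le zero_le_one] at ht
    have hx : M.vert p.1 (p.2 + 1) + t • (M.vert p.1 (p.2 + 2) - M.vert p.1 (p.2 + 1))
        ∈ M.edgeSegment p.1 p.2 := by
      rw [edgeSegment, segment_eq_image']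
      exact ⟨t, ht, rfl⟩
    have := hF p.1 q.1 p.2 q.2 m h.2 _ hx
    simp only [edgeNormal, Matrix.cons_val_zero, Matrix.cons_val_one] at this
    simp only [Pi.add_apply]
    rw [show M.vert p.1 (p.2 + 1) + M.shift m + t • (M.vert p.1 (p.2 + 2) + M.shift m
        - (M.vert p.1 (p.2 + 1) + M.shift m)) = M.vert p.1 (p.2 + 1)
        + t • (M.vert p.1 (p.2 + 2) - M.vert p.1 (p.2 + 1)) + M.shift m by module]
    linear_combination this
  have hsign : ∀ c d : ℝ, c * d < 0 → Real.sign c = -Real.sign d := fun c d hcd => by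
    rcases mul_neg_iff.1 hcd with ⟨h1, h2⟩ | ⟨h1, h2⟩
    · rw [Real.sign_of_pos h1, Real.sign_of_neg h2, neg_neg]
    · rw [Real.sign_of_neg h1, Real.sign_of_pos h2]
  rw [outwardFlux, outwardFlux, hflux]
  rcases Sym2.eq_iff.1 he with ⟨e1, e2⟩ | ⟨e1, e2⟩
  · rw [e1, e2, orient_opposite, orient_opposite] at hneg
    rw [e1, e2, hsign _ _ hneg]
    ring
  · rw [e1, e2, orient_swap (M.vert q.1 (q.2 + 1)), orient_opposite, orient_opposite] at hneg
    rw [e1, e2, hsign _ _ hneg, Real.sign_neg, flux_swap]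
    ring

variable (M) [Fintype ι]

/-- The total divergence of a piecewise `C¹` field with continuous normal components vanishes: the
edges of the mesh are paired off by an involution, and paired edges carry opposite fluxes. -/
theorem sum_integral_divergence_eq_zero {F : ι → Fin 2 → Plane → ℝ}
    (hC : ∀ T j, ContDiff ℝ 1 (F T j)) (hF : M.NormalContinuous F) :
    ∑ T, ∫ x in M.cell T, divergence (F T) x = 0 := by
  have hex : ∀ p : ι × Fin 3, ∃ q : ι × Fin 3, ∃ m, M.EdgeMatch p q m := fun p => by
    obtain ⟨T', i', m, h1, h2⟩ := M.conforming p.1 p.2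
    exact ⟨(T', i'), m, h1, h2⟩
  choose g m hg using hex
  have hsum : ∀ p : ι × Fin 3, outwardFlux (M.vert p.1) (F p.1) p.2
      + outwardFlux (M.vert (g p).1) (F (g p).1) (g p).2 = 0 := fun p => (hg p).outwardFlux_add hF
  calc ∑ T, ∫ x in M.cell T, divergence (F T) x
      = ∑ T, ∑ i, outwardFlux (M.vert T) (F T) i := Finset.sum_congr rfl fun T _ =>
        integral_divergence_triangle (M.orient_vert_ne_zero T) (hC T)
    _ = ∑ p : ι × Fin 3, outwardFlux (M.vert p.1) (F p.1) p.2 := by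
        rw [Fintype.sum_prod_type]
    _ = 0 := Finset.sum_ninvolution g hsum
        (fun p hp hgp => hp (by have := hsum p; rw [hgp] at this; linarith))
        (fun _ => Finset.mem_univ _) (fun p => (hg (g p)).unique (hg p).symm)

end PeriodicMesh

/-! ### Conservation of mass and of total vorticity -/

namespace PeriodicMesh

variable {ι : Type*} (M : PeriodicMesh ι)

theorem measurableSet_cell (T : ι) : MeasurableSet (M.cell T) :=
  (isCompact_triangle _).isClosed.measurableSet

theorem integrableOn_cell (T : ι) {f : Plane → ℝ} (hf : Continuous f) :
    IntegrableOn f (M.cell T) :=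
  hf.continuousOn.integrableOn_compact (isCompact_triangle _)

theorem one_mem_CG (N : ℕ) : (1 : ScalarField ι) ∈ M.CG N := by
  refine ⟨fun T => ?_, fun T T' m x _ _ => by simp⟩
  rw [MvPolynomial.mem_restrictTotalDegree]
  simp

/-- The Raviart-Thomas normal continuity survives multiplication by a continuous periodic scalar
given piecewise. -/
theorem normalContinuous_mul {N : ℕ} {u : VectorField ι} (hu : u ∈ M.RT N) {g : ι → Plane → ℝ}
    (hg : ∀ (T T' : ι) (m : Fin 2 → ℤ) (x : Plane), x ∈ M.cell T → x + M.shift m ∈ M.cell T' →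
      g T x = g T' (x + M.shift m)) :
    M.NormalContinuous fun T j x => MvPolynomial.eval x (u T j) * g T x := by
  intro T T' i i' m he x hx
  have h1 := hu.2 T T' i i' m he x hx
  simp only [normalComponent, Fin.sum_univ_two] at h1
  have hx' : x + M.shift m ∈ M.cell T' := by
    have hs : x + M.shift m ∈ segment ℝ (M.vert T (i + 1) + M.shift m)
        (M.vert T (i + 2) + M.shift m) := by
      rw [add_comm x, add_comm _ (M.shift m), add_comm _ (M.shift m)]
      exact (mem_segment_translate ℝ _).2 hx
    have he' : s(M.vert T (i + 1) + M.shift m, M.vert T (i + 2) + M.shift m)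
      = s(M.vert T' (i' + 1), M.vert T' (i' + 2)) := he
    refine edge_subset_triangle _ i' ?_
    rcases Sym2.eq_iff.1 he' with ⟨e1, e2⟩ | ⟨e1, e2⟩
    · rwa [e1, e2] at hs
    · rwa [e1, e2, segment_symm] at hs
  have h2 := hg T T' m x (edge_subset_triangle _ i hx) hx'
  simp only [← h2]
  linear_combination g T x * h1

theorem PointwiseDivFree.midpoint {M : PeriodicMesh ι} {u u' : VectorField ι}
    (h : M.PointwiseDivFree u) (h' : M.PointwiseDivFree u') :
    M.PointwiseDivFree ((1 / 2 : ℝ) • (u' + u)) := by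
  intro T x hx
  have h1 := h T x hx
  have h2 := h' T x hx
  simp only [div, Pi.smul_apply, Pi.add_apply, map_add, Derivation.map_smul,
    MvPolynomial.smul_eval] at h1 h2 ⊢
  linear_combination (1 / 2) * h1 + (1 / 2) * h2

variable [Fintype ι]

/-- The discrete constraint is tested with the divergence itself, which belongs to `DG_{N-1}`. -/
theorem DiscreteDivConstraint.pointwiseDivFree {M : PeriodicMesh ι} {N : ℕ} {u : VectorField ι}
    (hu : u ∈ M.RT N) (h : M.DiscreteDivConstraint N u) : M.PointwiseDivFree u := by
  intro T
  have h0 := h (div u) fun T => div_mem_polyLE (hu.1 T)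
  have hc : Continuous fun x => MvPolynomial.eval x (div u T) * MvPolynomial.eval x (div u T) :=
    (MvPolynomial.continuous_eval _).mul (MvPolynomial.continuous_eval _)
  have hT := (Finset.sum_eq_zero_iff_of_nonneg
    fun T _ => integral_nonneg fun x => mul_self_nonneg _).1 h0 T (Finset.mem_univ T)
  rw [setIntegral_eq_zero_iff_of_nonneg_ae (ae_of_all _ fun x => mul_self_nonneg _)
    (M.integrableOn_cell T hc)] at hT
  have := Measure.eqOn_of_ae_eq hT hc.continuousOn continuousOn_const
    (triangle_subset_closure_interior (M.orient_vert_ne_zero T))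
  exact fun x hx => mul_self_eq_zero.1 (this hx)

/-- A pointwise divergence-free Raviart-Thomas field is weakly divergence free. -/
theorem PointwiseDivFree.weaklyDivFree {M : PeriodicMesh ι} {N : ℕ} {u : VectorField ι}
    (hu : u ∈ M.RT N) (h : M.PointwiseDivFree u) : M.WeaklyDivFree u := by
  intro φ hφ hper
  rw [← M.sum_integral_divergence_eq_zero (F := fun T j x => MvPolynomial.eval x (u T j) * φ x)
    (fun T j => (contDiff_eval _ 1).mul hφ)
    (M.normalContinuous_mul hu fun T T' m x _ _ => (hper x m).symm)]
  refine Finset.sum_congr rfl fun T _ => setIntegral_congr_fun (M.measurableSet_cell T)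
    fun x hx => ?_
  have hd := h T x hx
  simp only [div, map_add] at hd
  have hv : (fun j => MvPolynomial.eval x (u T j)) = MvPolynomial.eval x (u T 0) • ![1, 0]
      + MvPolynomial.eval x (u T 1) • ![0, 1] := by
    ext i; fin_cases i <;> simp
  have hφx := hφ.differentiable one_ne_zero x
  have hj : ∀ j v, fderiv ℝ (fun x => MvPolynomial.eval x (u T j) * φ x) x v
      = MvPolynomial.eval x (u T j) * fderiv ℝ φ x v
        + φ x * fderiv ℝ (fun x => MvPolynomial.eval x (u T j)) x v := fun j v => by
    rw [fderiv_fun_mul (hasFDerivAt_eval _ x).differentiableAt hφx]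
    rfl
  simp only [divergence]
  rw [hj, hj, fderiv_eval_apply, fderiv_eval_apply, hv, map_add, map_smul, map_smul]
  simp only [smul_eq_mul, Matrix.cons_val_zero, Matrix.cons_val_one]
  linear_combination -φ x * hd

theorem inner_one (f : ScalarField ι) : M.inner f 1 = M.integral f := by
  simp [inner, integral]

theorem integral_smul_sub (c : ℝ) (f g : ScalarField ι) :
    M.integral (c • (f - g)) = c * (M.integral f - M.integral g) := by
  simp only [integral]
  rw [← Finset.sum_sub_distrib, Finset.mul_sum]
  refine Finset.sum_congr rfl fun T _ => ?_
  rw [← integral_sub (M.integrableOn_cell T (MvPolynomial.continuous_eval _))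
    (M.integrableOn_cell T (MvPolynomial.continuous_eval _)), ← integral_const_mul]
  simp [MvPolynomial.smul_eval]

/-- The product `u w` has continuous normal components, so its total divergence vanishes. -/
theorem integral_div_mulField {N : ℕ} {u : VectorField ι} {w : ScalarField ι} (hu : u ∈ M.RT N)
    (hw : w ∈ M.CG N) : M.integral (div (mulField u w)) = 0 := by
  rw [← M.sum_integral_divergence_eq_zero
    (F := fun T j x => MvPolynomial.eval x (u T j) * MvPolynomial.eval x (w T))
    (fun T j => (contDiff_eval _ 1).mul (contDiff_eval _ 1))
    (M.normalContinuous_mul hu hw.2)]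
  refine Finset.sum_congr rfl fun T _ => integral_congr_ae (ae_of_all _ fun x => ?_)
  simp only [divergence, ← map_mul, fderiv_eval_apply, div, mulField, map_add]
  simp

/-- Testing the vorticity equation with `ξ = 1` leaves only the time difference. -/
theorem VorticityEquation.integral_eq {M : PeriodicMesh ι} {N : ℕ} {ν σ Δt : ℝ} (hΔt : Δt ≠ 0)
    {u : VectorField ι} {w w' : ScalarField ι} (h : M.VorticityEquation N ν σ Δt u w w')
    (hu : u ∈ M.RT N) (hdiv : M.PointwiseDivFree u) (hw : w ∈ M.CG N) (hw' : w' ∈ M.CG N) :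
    M.integral w' = M.integral w := by
  have h1 := h 1 (M.one_mem_CG N)
  have hm : mulField u (1 : ScalarField ι) = u := by
    ext1 T; ext1 i; simp [mulField]
  have hcurl : curl (1 : ScalarField ι) = 0 := by
    ext1 T; ext1 i; fin_cases i <;> simp [curl]
  have hz : ∀ f : ScalarField ι, M.inner f (div u) = 0 := fun f =>
    Finset.sum_eq_zero fun T _ => setIntegral_eq_zero_of_forall_eq_zero fun x hx => by
      rw [hdiv T x hx, mul_zero]
  have hv : ∀ v : VectorField ι, M.vinner v 0 = 0 := fun v => by simp [vinner]
  rw [hm, hcurl, hz, hv, inner_one, inner_one, integral_smul_sub, M.integral_div_mulField hu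
    ((M.CG N).smul_mem _ ((M.CG N).add_mem hw' hw))] at h1
  have h2 : Δt⁻¹ * (M.integral w' - M.integral w) = 0 := by linear_combination h1
  exact sub_eq_zero.1 ((mul_eq_zero.1 h2).resolve_left (inv_ne_zero hΔt))

end PeriodicMesh

end MEEVC

theorem mainTheorem1 {ι : Type*} [Fintype ι] (M : MEEVC.PeriodicMesh ι) (N : ℕ) (hN : 1 ≤ N)
    (ν σ Δt : ℝ) (hσ : σ = 1 ∨ σ = -1) (hΔt : Δt ≠ 0) :
    (∀ (K : ℕ) (u : ℕ → MEEVC.VectorField ι) (p w : ℕ → MEEVC.ScalarField ι),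
      M.IsStaggeredRun N ν σ Δt K u p w →
        (∀ k ≤ K, M.PointwiseDivFree (u k) ∧ M.WeaklyDivFree (u k)) ∧
        (∀ k < K, M.integral (w (k + 1)) = M.integral (w k))) ∧
    (∀ (u₀ u₁ : MEEVC.VectorField ι) (p w₀ w₁ : MEEVC.ScalarField ι),
      u₀ ∈ M.RT N → w₀ ∈ M.CG N → M.DiscreteDivConstraint N u₀ →
      M.IsImplicitStep N ν σ Δt u₀ w₀ u₁ p w₁ →
        (∀ v ∈ ({u₀, u₁, (1 / 2 : ℝ) • (u₁ + u₀)} : Set (MEEVC.VectorField ι)),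
          M.PointwiseDivFree v ∧ M.WeaklyDivFree v) ∧
        M.integral w₁ = M.integral w₀) := by
  constructor
  · intro K u p w h
    have hu : ∀ k ≤ K, u k ∈ M.RT N ∧ M.PointwiseDivFree (u k) := fun k hk => by
      cases k with
      | zero => exact ⟨h.velocity_mem, h.divergence.pointwiseDivFree h.velocity_mem⟩
      | succ k =>
        have hs := h.step k hk
        exact ⟨hs.velocity_mem, hs.divergence.pointwiseDivFree hs.velocity_mem⟩
    have hw : ∀ k ≤ K, w k ∈ M.CG N := fun k hk => by
      cases k with
      | zero => exact h.vorticity_mem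
      | succ k => exact (h.step k hk).vorticity_mem
    exact ⟨fun k hk => ⟨(hu k hk).2, (hu k hk).2.weaklyDivFree (hu k hk).1⟩, fun k hk =>
      (h.step k hk).vorticity.integral_eq hΔt (hu k hk.le).1 (hu k hk.le).2 (hw k hk.le)
        (hw (k + 1) hk)⟩
  · intro u₀ u₁ p w₀ w₁ hu₀ hw₀ hd₀ h
    have hu₁ := h.velocity_mem
    have d₀ := hd₀.pointwiseDivFree hu₀
    have d₁ := h.divergence.pointwiseDivFree hu₁
    have hu : (1 / 2 : ℝ) • (u₁ + u₀) ∈ M.RT N :=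
      (M.RT N).smul_mem _ ((M.RT N).add_mem hu₁ hu₀)
    refine ⟨?_, h.vorticity.integral_eq hΔt hu (d₀.midpoint d₁) hw₀ h.vorticity_mem⟩
    rintro v (rfl | rfl | rfl)
    · exact ⟨d₀, d₀.weaklyDivFree hu₀⟩
    · exact ⟨d₁, d₁.weaklyDivFree hu₁⟩
    · exact ⟨d₀.midpoint d₁, (d₀.midpoint d₁).weaklyDivFree hu⟩
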